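/- Let $G$ be a finite bidirected graph: it has finite sets $V$ of vertices, $E$ of edges and $I$ of incidences, each $i\in I$ belongs to one vertex and one edge, every edge has exactly two incidences (loops and parallel edges are allowed), and $\sigma:I\to\{+1,-1\}$ is an orientation. The sign of an edge with incidences $i\neq j$ is $-\sigma(i)\sigma(j)$; with this labeling $G$ is a signed graph. Let $u_1,u_2,w_1,w_2\in V$. *Tutte's transpedance.* A 2-arborescence of $G$ is a pair of vertex-disjoint rooted trees in $G$ whose union spans $V$. Let $\langle u_1w_1,u_2w_2\rangle$ be the number of 2-arborescences with one component rooted at $u_1$ and containing $w_1$ and the other rooted at $u_2$ and containing $w_2$, and put $$[u_1u_2,w_1w_2]=\langle u_1w_1,u_2w_2\rangle-\langle u_1w_2,u_2w_1\rangle .$$ *Contributor transpedance.* If $u_1\ne u_2$ and $w_1\neq w_2$, a (non-zero) reduced contributor $c$ for $(u_1u_2,w_1w_2)$ consists of a permutation $\pi$ of $V$ with $\pi(u_1)=w_1$, $\pi(u_2)=w_2$ and, for each $v\in V\setminus\{u_1,u_2\}$, a pair of incidences $(t_v,h_v)$ of one and the same edge with $t_v$ at $v$ and $h_v$ at $\pi(v)$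 (no edges of $G$ are required for $u_1\mapsto w_1$ and $u_2\mapsto w_2$). If $u_1=u_2$ or $w_1=w_2$, there are no reduced contributors. The vertex $v\in V\setminus\{u_1,u_2\}$ is a backstep of $c$ if $t_v=h_v$. The components of $c$ are the connected components of the graph on $V$ that joins $v$ to $\pi(v)$ for $v\in V\setminus\{u_1,u_2\}$; a component is negative if the product of $-\sigma(t_v)\sigma(h_v)$ over its vertices $v\in V\setminus\{u_1,u_2\}$ that are not backsteps is $-1$. Let $ec(\check c)$ be the number of cycles of even length of $\pi$, $nc(c)$ the number of negative components and $bs(c)$ the number of backsteps, and put $$[u_1u_2,w_1w_2]_D=\sum_{c}(-1)^{ec(\check c)+nc(c)+bs(c)},$$ the sum being over all reduced contributors $c$ for $(u_1u_2,w_1w_2)$. **Statement.** If every edge of $G$ is positive, then $$[u_1u_2,w_1w_2]=(-1)^{|V|}\,[u_1u_2,w_1w_2]_D .$$ -/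

import Mathlib

/-- An oriented incidence hypergraph: vertices `V`, edges `E`, incidences `I`, the two incidence
maps and an orientation, which signs every incidence by `+1` or `-1`. Loops and parallel edges
are allowed. -/
structure OrientedHypergraph (V E I : Type*) where
  /-- the vertex of an incidence -/
  vert : I → V
  /-- the edge of an incidence -/
  edge : I → E
  /-- the orientation -/
  sign : I → ℤˣ

namespace OrientedHypergraph

variable {V E I : Type*}

/-- A bidirected graph: every edge has exactly two incidences (a loop has both of its incidences
at the same vertex). -/
def IsBidirected (G : OrientedHypergraph V E I) : Prop :=
  ∀ e : E, {i : I | G.edge i = e}.ncard = 2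

/-- The sign of the adjacency that uses the incidences `i` and `j`. -/
def adjSign (G : OrientedHypergraph V E I) (i j : I) : ℤˣ :=
  -(G.sign i * G.sign j)

/-- Every edge of the signed graph is positive. -/
def AllPositive (G : OrientedHypergraph V E I) : Prop :=
  ∀ i j : I, i ≠ j → G.edge i = G.edge j → G.adjSign i j = 1

/-! ### Trees and `2`-arborescences -/

/-- `x` and `y` are the two ends of the edge `e`. -/
def IsLink (G : OrientedHypergraph V E I) (e : E) (x y : V) : Prop :=
  ∃ i j : I, i ≠ j ∧ G.edge i = e ∧ G.edge j = e ∧ G.vert i = x ∧ G.vert j = y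

/-- The simple graph on the vertex set `S` in which two distinct vertices are adjacent when they
are joined by an edge of `F`. -/
def simpleGraphOn (G : OrientedHypergraph V E I) (S : Set V) (F : Set E) : SimpleGraph S :=
  SimpleGraph.fromRel fun x y => ∃ e ∈ F, G.IsLink e x y

/-- The vertices `S` and the edges `F` form a subgraph of `G` that is a tree: the ends of the edges
in `F` lie in `S`, there are no loops, no parallel edges, and the resulting simple graph
is a tree (connected, hence nonempty, and acyclic). -/
structure IsSubtree (G : OrientedHypergraph V E I) (S : Set V) (F : Set E) : Prop where
  ends_mem : ∀ e ∈ F, ∀ x y, G.IsLink e x y → x ∈ S ∧ y ∈ S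
  loopless : ∀ e ∈ F, ∀ x, ¬ G.IsLink e x x
  no_parallel : ∀ e ∈ F, ∀ f ∈ F, ∀ x y, G.IsLink e x y → G.IsLink f x y → e = f
  isTree : (G.simpleGraphOn S F).IsTree

/-- A tree in `G` with a distinguished root. -/
structure RootedTree (G : OrientedHypergraph V E I) where
  verts : Set V
  edges : Set E
  root : V
  isSubtree : G.IsSubtree verts edges
  root_mem : root ∈ verts

/-- A `2`-arborescence: a pair of disjoint rooted trees whose union spans `G`. -/
structure TwoArborescence (G : OrientedHypergraph V E I) where
  first : G.RootedTree
  second : G.RootedTree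
  disjoint : Disjoint first.verts second.verts
  spans : first.verts ∪ second.verts = Set.univ

/-- `⟨u₁ w₁, u₂ w₂⟩`: the number of `2`-arborescences with one component rooted at `u₁` and
containing `w₁`, and the other component rooted at `u₂` and containing `w₂`. -/
noncomputable def twoArborescenceCount (G : OrientedHypergraph V E I) (u₁ w₁ u₂ w₂ : V) : ℕ :=
  {A : G.TwoArborescence | A.first.root = u₁ ∧ w₁ ∈ A.first.verts ∧
    A.second.root = u₂ ∧ w₂ ∈ A.second.verts}.ncard

/-- Tutte's transpedance `[u₁ u₂, w₁ w₂]`. -/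
noncomputable def transpedance (G : OrientedHypergraph V E I) (u₁ u₂ w₁ w₂ : V) : ℤ :=
  (G.twoArborescenceCount u₁ w₁ u₂ w₂ : ℤ) - (G.twoArborescenceCount u₁ w₂ u₂ w₁ : ℤ)

/-! ### Contributors -/

/-- A non-zero reduced contributor for `u₁ ↦ w₁`, `u₂ ↦ w₂`.

A contributor sends each vertex `v` to a directed path of length one `v, i, e, j, v'` (with tail
incidence `i` at `v`, head incidence `j` at `v'`, both in the same edge `e`; `i = j` is a backstep),
so that the heads cover the vertex set, that is, `v ↦ v'` is a permutation. Here the two paths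
`u₁ ↦ w₁` and `u₂ ↦ w₂`, which need not exist in `G` (they exist in the zero-loading of `G`), have
been removed, and all the remaining paths lie in `G`.

The permutation `perm` belongs to the unreduced contributor; it is determined by the other data.
The pairs `u₁, u₂` and `w₁, w₂` are orderings of two-element sets; there is no reduced contributor
when `u₁ = u₂` or when `w₁ = w₂`. -/
structure ReducedContributor (G : OrientedHypergraph V E I) (u₁ u₂ w₁ w₂ : V) where
  perm : Equiv.Perm V
  tail : {v : V // v ≠ u₁ ∧ v ≠ u₂} → I
  head : {v : V // v ≠ u₁ ∧ v ≠ u₂} → I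
  source_ne : u₁ ≠ u₂
  target_ne : w₁ ≠ w₂
  perm_fst : perm u₁ = w₁
  perm_snd : perm u₂ = w₂
  vert_tail : ∀ v, G.vert (tail v) = v
  edge_head : ∀ v, G.edge (head v) = G.edge (tail v)
  vert_head : ∀ v, G.vert (head v) = perm v

namespace ReducedContributor

variable {G : OrientedHypergraph V E I} {u₁ u₂ w₁ w₂ : V}

instance [Finite V] [Finite I] : Finite (G.ReducedContributor u₁ u₂ w₁ w₂) := by
  refine Finite.of_injective (β := Equiv.Perm V × ({v : V // v ≠ u₁ ∧ v ≠ u₂} → I) ×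
    ({v : V // v ≠ u₁ ∧ v ≠ u₂} → I)) (fun c => (c.perm, c.tail, c.head)) ?_
  rintro ⟨p, t, h⟩ ⟨p', t', h'⟩ H
  simp only [Prod.mk.injEq] at H
  obtain ⟨rfl, rfl, rfl⟩ := H
  rfl

noncomputable instance [Finite V] [Finite I] : Fintype (G.ReducedContributor u₁ u₂ w₁ w₂) :=
  Fintype.ofFinite _

/-- The number of backsteps. -/
noncomputable def bs (c : G.ReducedContributor u₁ u₂ w₁ w₂) : ℕ :=
  {v | c.tail v = c.head v}.ncard

/-- The graph on `V` in which each vertex is joined to its image under the reduced contributor.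
Its connected components are the components (circles, paths, backsteps) of the contributor. -/
def componentGraph (c : G.ReducedContributor u₁ u₂ w₁ w₂) : SimpleGraph V :=
  SimpleGraph.fromRel fun x y => (x ≠ u₁ ∧ x ≠ u₂) ∧ c.perm x = y

open Classical in
/-- The sign of a component: the product of the signs of the adjacencies in it. A backstep
does not complete an adjacency. -/
noncomputable def componentSign [Fintype V] (c : G.ReducedContributor u₁ u₂ w₁ w₂)
    (K : c.componentGraph.ConnectedComponent) : ℤˣ :=
  ∏ v ∈ Finset.univ.filter fun v =>
      c.componentGraph.connectedComponentMk v.1 = K ∧ c.tail v ≠ c.head v,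
    G.adjSign (c.tail v) (c.head v)

/-- The number of negative components. -/
noncomputable def nc [Fintype V] (c : G.ReducedContributor u₁ u₂ w₁ w₂) : ℕ :=
  {K : c.componentGraph.ConnectedComponent | c.componentSign K = -1}.ncard

open Classical in
/-- The number of even cycles of the unreduced contributor. -/
noncomputable def ec [Fintype V] (c : G.ReducedContributor u₁ u₂ w₁ w₂) : ℕ :=
  (c.perm.cycleType.filter Even).card

/-- The determinant-sign of a reduced contributor. -/
noncomputable def sgnD [Fintype V] (c : G.ReducedContributor u₁ u₂ w₁ w₂) : ℤ :=
  (-1) ^ (c.ec + c.nc + c.bs)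

end ReducedContributor

/-- The `D`-contributor-transpedance `[u₁ u₂, w₁ w₂]_D`. -/
noncomputable def contributorTranspedance [Fintype V] [Finite I] (G : OrientedHypergraph V E I)
    (u₁ u₂ w₁ w₂ : V) : ℤ :=
  ∑ c : G.ReducedContributor u₁ u₂ w₁ w₂, c.sgnD

end OrientedHypergraph

/-! Let m = |V| - 2, let b_e ∈ ℤ^V be the column of the edge e in the oriented incidence matrix, and
let L = ∑ b_e b_eᵀ. Up to the factor (-1)^m, the contributor sum is the Leibniz expansion of the
determinant of L with rows u₁, u₂ replaced by the unit vectors at w₁, w₂: (-1)^ec is the sign of π,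
no component is negative, and -σ(t)σ(h) is -1 at a backstep and 1 elsewhere
(`contributorTranspedance_eq`).

By Cauchy-Binet (`factorial_mul_borderedDet`), m! times this determinant is a sum over maps φ from V
∖ {u₁, u₂} to E. Each term is a product of two determinants with the same rows b_φ(v), bordered by
the unit vectors at u₁, u₂ in one and at w₁, w₂ in the other. Positivity gives b_e = ±(unit x - unit
y). So, modulo the edge rows, the unit vectors within a component of the chosen subgraph agree,
while the indicator of a component is orthogonal to the edge rows. The product is therefore 1 if φ
is injective and its edges leave two components pairing u₁ with w₁ and u₂ with w₂, it is -1 for the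
crossed pairing, and 0 otherwise (`borderedDet_mul_borderedDet`).

Each set of m edges is the range of m! injections, which cancels the factorial. Having m edges and
two components forces both components to be trees, so these edge sets are exactly the
2-arborescences with roots u₁, u₂ (`twoArborescenceCount_eq`). Finally (-1)^m = (-1)^|V|. -/

/-! ### Determinants with two prescribed rows -/

section BorderedDeterminant

variable {V E : Type*} [DecidableEq V] {u₁ u₂ : V}

/-- The matrix whose row `u₁` is `p`, whose row `u₂` is `q`, and whose other rows are given
by `f`. -/
def borderedMatrix (f : {v : V // v ≠ u₁ ∧ v ≠ u₂} → V → ℤ) (p q : V → ℤ) : Matrix V V ℤ :=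
  Matrix.of fun v => if h : v ≠ u₁ ∧ v ≠ u₂ then f ⟨v, h⟩ else if v = u₁ then p else q

lemma borderedMatrix_apply (f : {v : V // v ≠ u₁ ∧ v ≠ u₂} → V → ℤ) (p q : V → ℤ)
    (v : {v : V // v ≠ u₁ ∧ v ≠ u₂}) : borderedMatrix f p q v = f v := by
  ext w
  simp [borderedMatrix, v.2]

lemma borderedMatrix_fst (f : {v : V // v ≠ u₁ ∧ v ≠ u₂} → V → ℤ) (p q : V → ℤ) :
    borderedMatrix f p q u₁ = p := by
  ext w
  simp [borderedMatrix]

lemma borderedMatrix_snd (hu : u₁ ≠ u₂) (f : {v : V // v ≠ u₁ ∧ v ≠ u₂} → V → ℤ)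
    (p q : V → ℤ) : borderedMatrix f p q u₂ = q := by
  ext w
  simp [borderedMatrix, hu.symm]

lemma forall_of_border (u₁ u₂ : V) {P : V → Prop} (h₁ : P u₁) (h₂ : P u₂)
    (h : ∀ v : {v : V // v ≠ u₁ ∧ v ≠ u₂}, P v) (v : V) : P v := by
  by_cases hv₁ : v = u₁
  · rwa [hv₁]
  by_cases hv₂ : v = u₂
  · rwa [hv₂]
  exact h ⟨v, hv₁, hv₂⟩

variable [Fintype V]

/-- The determinant of a bordered matrix. -/
def borderedDet (f : {v : V // v ≠ u₁ ∧ v ≠ u₂} → V → ℤ) (p q : V → ℤ) : ℤ :=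
  (borderedMatrix f p q).det

lemma borderedDet_sum [Fintype E] (X : {v : V // v ≠ u₁ ∧ v ≠ u₂} → E → ℤ) (b : E → V → ℤ)
    (p q : V → ℤ) :
    borderedDet (fun v => ∑ e, X v e • b e) p q =
      ∑ φ : {v : V // v ≠ u₁ ∧ v ≠ u₂} → E,
        (∏ v, X v (φ v)) * borderedDet (fun v => b (φ v)) p q := by
  -- With the two border rows frozen, the determinant remains multilinear in the other rows.
  have key : ∀ f : {v : V // v ≠ u₁ ∧ v ≠ u₂} → V → ℤ, borderedDet f p q =
      ((Matrix.detRowAlternating (n := V) (R := ℤ)).toMultilinearMap.domDomRestrict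
        (fun v => v ≠ u₁ ∧ v ≠ u₂) fun v => if v.1 = u₁ then p else q) f := fun f => rfl
  simp only [key]
  rw [MultilinearMap.map_sum]
  refine Finset.sum_congr rfl fun φ _ => ?_
  rw [MultilinearMap.map_smul_univ]
  rfl

lemma borderedDet_comp_perm (f : {v : V // v ≠ u₁ ∧ v ≠ u₂} → V → ℤ) (p q : V → ℤ)
    (τ : Equiv.Perm {v : V // v ≠ u₁ ∧ v ≠ u₂}) :
    borderedDet (fun v => f (τ v)) p q = Equiv.Perm.sign τ * borderedDet f p q := by
  have h := Matrix.det_permute (Equiv.Perm.ofSubtype τ) (borderedMatrix f p q)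
  rw [Equiv.Perm.sign_ofSubtype] at h
  refine Eq.trans (congrArg Matrix.det ?_) h
  ext v w
  simp only [Matrix.submatrix_apply, id]
  by_cases hv : v ≠ u₁ ∧ v ≠ u₂
  · rw [Equiv.Perm.ofSubtype_apply_of_mem τ hv]
    exact (congrFun (borderedMatrix_apply (fun v => f (τ v)) p q ⟨v, hv⟩) w).trans
      (congrFun (borderedMatrix_apply f p q (τ ⟨v, hv⟩)) w).symm
  · rw [Equiv.Perm.ofSubtype_apply_of_not_mem τ hv]
    simp only [borderedMatrix, Matrix.of_apply, dif_neg hv]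

/-- The border rows vanish outside the columns u₁, u₂, so the matrix is block triangular with an
identity block. This puts the minors of Cauchy-Binet in the same form as the other factor. -/
lemma borderedDet_single (hu : u₁ ≠ u₂) (f : {v : V // v ≠ u₁ ∧ v ≠ u₂} → V → ℤ) :
    borderedDet f (Pi.single u₁ 1) (Pi.single u₂ 1) =
      (Matrix.of fun v w : {v : V // v ≠ u₁ ∧ v ≠ u₂} => f v w).det := by
  rw [borderedDet, Matrix.twoBlockTriangular_det _ (fun v => v ≠ u₁ ∧ v ≠ u₂)]
  · have h₁ : (borderedMatrix f (Pi.single u₁ 1) (Pi.single u₂ 1)).toSquareBlockProp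
        (fun v => ¬(v ≠ u₁ ∧ v ≠ u₂)) = 1 := by
      ext ⟨v, hv⟩ ⟨w, hw⟩
      rw [Matrix.toSquareBlockProp_def, Matrix.of_apply, Matrix.one_apply]
      simp only [Subtype.mk.injEq]
      by_cases hv₁ : v = u₁
      · subst hv₁
        rw [borderedMatrix_fst, Pi.single_apply]
        simp only [eq_comm]
      · have hv₂ : v = u₂ := by tauto
        subst hv₂
        rw [borderedMatrix_snd hu, Pi.single_apply]
        simp only [eq_comm]
    rw [h₁, Matrix.det_one, mul_one]
    congr 1
    ext v w
    exact congrFun (borderedMatrix_apply f _ _ v) w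
  · intro i hi j hj
    by_cases hi₁ : i = u₁
    · rw [hi₁, borderedMatrix_fst, Pi.single_eq_of_ne hj.1]
    · have hi₂ : i = u₂ := by tauto
      rw [hi₂, borderedMatrix_snd hu, Pi.single_eq_of_ne hj.2]

/-- A symmetrized form of the Cauchy-Binet formula for bordered determinants. -/
lemma factorial_mul_borderedDet [Fintype E] (hu : u₁ ≠ u₂) (b : E → V → ℤ) (p q : V → ℤ) :
    ((Fintype.card {v : V // v ≠ u₁ ∧ v ≠ u₂}).factorial : ℤ) *
      borderedDet (u₁ := u₁) (u₂ := u₂) (fun v => ∑ e, b e v • b e) p q =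
    ∑ φ : {v : V // v ≠ u₁ ∧ v ≠ u₂} → E,
      borderedDet (fun v => b (φ v)) (Pi.single u₁ 1) (Pi.single u₂ 1) *
        borderedDet (fun v => b (φ v)) p q := by
  -- Replacing φ by φ ∘ τ permutes the terms of the multilinear expansion. Summing over all τ turns
  -- the product of entries into a determinant, at the cost of the factorial and without ordering
  -- the edges.
  have h : ∀ τ : Equiv.Perm {v : V // v ≠ u₁ ∧ v ≠ u₂},
      borderedDet (u₁ := u₁) (u₂ := u₂) (fun v => ∑ e, b e v • b e) p q =
      ∑ φ : {v : V // v ≠ u₁ ∧ v ≠ u₂} → E, (Equiv.Perm.sign τ * ∏ v, b (φ (τ v)) v) *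
        borderedDet (fun v => b (φ v)) p q := by
    intro τ
    rw [borderedDet_sum (fun v e => b e v.1)]
    refine ((Equiv.arrowCongr τ.symm (Equiv.refl E)).sum_comp _).symm.trans ?_
    refine Finset.sum_congr rfl fun φ _ => ?_
    simp only [Equiv.arrowCongr_apply, Equiv.symm_symm, Equiv.coe_refl, Function.comp_def, id]
    rw [borderedDet_comp_perm (fun v => b (φ v))]
    ring
  rw [← Fintype.card_perm, ← Finset.card_univ, ← nsmul_eq_mul, ← Finset.sum_const]
  rw [Finset.sum_congr rfl fun τ _ => h τ, Finset.sum_comm]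
  refine Finset.sum_congr rfl fun φ _ => ?_
  rw [← Finset.sum_mul, borderedDet_single hu, Matrix.det_apply']
  rfl

lemma borderedDet_swap (hu : u₁ ≠ u₂) (f : {v : V // v ≠ u₁ ∧ v ≠ u₂} → V → ℤ)
    (p q : V → ℤ) : borderedDet f q p = -borderedDet f p q := by
  have h := Matrix.det_permute (Equiv.swap u₁ u₂) (borderedMatrix f p q)
  rw [Equiv.Perm.sign_swap hu] at h
  simp only [Units.val_neg, Units.val_one, Int.cast_neg, Int.cast_one, neg_one_mul] at h
  rw [borderedDet, borderedDet, ← h]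
  congr 1
  refine funext (forall_of_border u₁ u₂ ?_ ?_ fun v => ?_)
  · change _ = borderedMatrix f p q (Equiv.swap u₁ u₂ u₁)
    rw [borderedMatrix_fst, Equiv.swap_apply_left, borderedMatrix_snd hu]
  · change _ = borderedMatrix f p q (Equiv.swap u₁ u₂ u₂)
    rw [borderedMatrix_snd hu, Equiv.swap_apply_right, borderedMatrix_fst]
  · change _ = borderedMatrix f p q (Equiv.swap u₁ u₂ v)
    rw [Equiv.swap_apply_of_ne_of_ne v.2.1 v.2.2, borderedMatrix_apply, borderedMatrix_apply]

/-- The determinant is linear in its border row and vanishes when that row repeats a row of `f`. -/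
lemma borderedDet_congr_left {f : {v : V // v ≠ u₁ ∧ v ≠ u₂} → V → ℤ} {p p' : V → ℤ}
    (q : V → ℤ) (h : p - p' ∈ Submodule.span ℤ (Set.range f)) :
    borderedDet f p q = borderedDet f p' q := by
  have key : ∀ s, borderedDet f s q = 
      (Matrix.detRowAlternating (n := V) (R := ℤ)).toMultilinearMap.toLinearMap
        (borderedMatrix f 0 q) u₁ s := by
    intro s
    change _ = ((borderedMatrix f 0 q).updateRow u₁ s).det
    refine congrArg Matrix.det (Matrix.ext fun v w => ?_)
    by_cases hv : v = u₁
    · subst hv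
      rw [borderedMatrix_fst, Matrix.updateRow_self]
    · rw [Matrix.updateRow_ne hv]
      simp [borderedMatrix, hv]
  rw [← sub_eq_zero, key, key, ← map_sub, ← LinearMap.mem_ker]
  refine Submodule.span_le.2 ?_ h
  rintro _ ⟨v, rfl⟩
  rw [SetLike.mem_coe, LinearMap.mem_ker, ← key]
  refine Matrix.det_zero_of_row_eq (i := u₁) (j := v) v.2.1.symm ?_
  rw [borderedMatrix_fst, borderedMatrix_apply]

lemma borderedDet_congr_right (hu : u₁ ≠ u₂) {f : {v : V // v ≠ u₁ ∧ v ≠ u₂} → V → ℤ}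
    {q q' : V → ℤ} (p : V → ℤ) (h : q - q' ∈ Submodule.span ℤ (Set.range f)) :
    borderedDet f p q = borderedDet f p q' := by
  rw [← neg_inj, ← borderedDet_swap hu, ← borderedDet_swap hu, borderedDet_congr_left p h]

lemma borderedDet_self (hu : u₁ ≠ u₂) (f : {v : V // v ≠ u₁ ∧ v ≠ u₂} → V → ℤ) (p : V → ℤ) :
    borderedDet f p p = 0 :=
  Matrix.det_zero_of_row_eq hu (by rw [borderedMatrix_fst, borderedMatrix_snd hu])

lemma borderedDet_eq_zero_of_not_injective {f : {v : V // v ≠ u₁ ∧ v ≠ u₂} → V → ℤ}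
    (hf : ¬ Function.Injective f) (p q : V → ℤ) : borderedDet f p q = 0 := by
  simp only [Function.Injective, not_forall] at hf
  obtain ⟨v, w, h, hvw⟩ := hf
  refine Matrix.det_zero_of_row_eq (i := v.1) (j := w.1) (fun h => hvw (Subtype.ext h)) ?_
  rw [borderedMatrix_apply, borderedMatrix_apply, h]

/-- The rows generate ℤ^V, so the matrix is invertible over ℤ and its determinant is 1 or -1. -/
lemma borderedDet_mul_self (hu : u₁ ≠ u₂) (f : {v : V // v ≠ u₁ ∧ v ≠ u₂} → V → ℤ)
    (p q : V → ℤ)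
    (h : ∀ v, Pi.single v 1 ∈ Submodule.span ℤ (Set.range f) ⊔ Submodule.span ℤ {p, q}) :
    borderedDet f p q * borderedDet f p q = 1 := by
  have hspan : Submodule.span ℤ (Set.range (borderedMatrix f p q).row) = ⊤ := by
    rw [eq_top_iff, ← (Pi.basisFun ℤ V).span_eq, Submodule.span_le]
    rintro _ ⟨v, rfl⟩
    rw [Pi.basisFun_apply]
    refine (sup_le ?_ ?_ : _ ≤ Submodule.span ℤ (Set.range (borderedMatrix f p q).row)) (h v)
    · refine Submodule.span_mono ?_
      rintro _ ⟨v, rfl⟩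
      exact ⟨v, borderedMatrix_apply f p q v⟩
    · refine Submodule.span_mono ?_
      rintro _ (rfl | rfl)
      exacts [⟨u₁, borderedMatrix_fst f _ q⟩, ⟨u₂, borderedMatrix_snd hu f p _⟩]
  rw [← range_vecMulLinear, LinearMap.range_eq_top] at hspan
  have hunit : IsUnit (borderedMatrix f p q) := Matrix.vecMul_surjective_iff_isUnit.1 hspan
  rw [Matrix.isUnit_iff_isUnit_det] at hunit
  exact Int.isUnit_mul_self hunit

lemma borderedDet_eq_zero_of_dotProduct (hu : u₁ ≠ u₂)
    {f : {v : V // v ≠ u₁ ∧ v ≠ u₂} → V → ℤ} {p q x : V → ℤ} (hx : x ≠ 0)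
    (hf : ∀ v, f v ⬝ᵥ x = 0) (hp : p ⬝ᵥ x = 0) (hq : q ⬝ᵥ x = 0) : borderedDet f p q = 0 := by
  refine Matrix.exists_mulVec_eq_zero_iff.1 ⟨x, hx, funext (forall_of_border u₁ u₂ ?_ ?_ fun v => ?_)⟩
  · change borderedMatrix f p q u₁ ⬝ᵥ x = 0
    rwa [borderedMatrix_fst]
  · change borderedMatrix f p q u₂ ⬝ᵥ x = 0
    rwa [borderedMatrix_snd hu]
  · change borderedMatrix f p q v ⬝ᵥ x = 0
    rw [borderedMatrix_apply, hf]

end BorderedDeterminant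

/-! ### Signs of contributors and the contributor sum as a determinant -/

/-- The factor -(-1)^n is the sign of an n-cycle: -1 exactly for even n. Applied to a cycle type,
the product is the sign of the permutation. -/
lemma Multiset.neg_one_pow_card_filter_even (s : Multiset ℕ) :
    (-1 : ℤˣ) ^ (s.filter Even).card = (s.map fun n => -(-1 : ℤˣ) ^ n).prod := by
  induction s using Multiset.induction_on with
  | empty => simp
  | cons a s ih =>
    by_cases ha : Even a
    · rw [Multiset.filter_cons_of_pos _ ha, Multiset.card_cons, Multiset.map_cons,
        Multiset.prod_cons, pow_succ', ih, ha.neg_one_pow]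
    · rw [Multiset.filter_cons_of_neg _ ha, Multiset.map_cons, Multiset.prod_cons, ih,
        (Nat.not_even_iff_odd.1 ha).neg_one_pow, neg_neg, one_mul]

lemma prod_eq_mul_mul_prod_subtype {V M : Type*} [Fintype V] [DecidableEq V] [CommMonoid M]
    {u₁ u₂ : V} (hu : u₁ ≠ u₂) (F : V → M) :
    ∏ v, F v = F u₁ * F u₂ * ∏ v : {v : V // v ≠ u₁ ∧ v ≠ u₂}, F v := by
  rw [← Finset.mul_prod_erase _ F (Finset.mem_univ u₁),
    ← Finset.mul_prod_erase _ F (Finset.mem_erase.2 ⟨hu.symm, Finset.mem_univ u₂⟩), mul_assoc]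
  congr 2
  refine Finset.prod_subtype _ (fun v => ?_) F
  simp [and_comm]

namespace OrientedHypergraph

variable {V E I : Type*}

namespace ReducedContributor

variable {G : OrientedHypergraph V E I} {u₁ u₂ w₁ w₂ : V}

lemma nc_eq_zero [Fintype V] (hpos : G.AllPositive) (c : G.ReducedContributor u₁ u₂ w₁ w₂) :
    c.nc = 0 := by
  classical
  have h : ∀ K, c.componentSign K = 1 := fun K => Finset.prod_eq_one fun v hv =>
    hpos _ _ (Finset.mem_filter.1 hv).2.2 (c.edge_head v).symm
  simp only [nc, h]
  have : ¬ (1 : ℤˣ) = -1 := by decide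
  simp [this]

lemma neg_one_pow_ec [Fintype V] [DecidableEq V] (c : G.ReducedContributor u₁ u₂ w₁ w₂) :
    (-1 : ℤ) ^ c.ec = (Equiv.Perm.sign c.perm : ℤ) := by
  have h := (Multiset.neg_one_pow_card_filter_even c.perm.cycleType).trans
    (Equiv.Perm.sign_of_cycleType' c.perm).symm
  rw [← h]
  push_cast
  unfold ec
  congr!

/-- A backstep contributes -σ² = -1; any other vertex contributes the sign of a positive edge. -/
lemma neg_one_pow_bs [Fintype V] [DecidableEq V] (hpos : G.AllPositive)
    (c : G.ReducedContributor u₁ u₂ w₁ w₂) :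
    (-1 : ℤ) ^ c.bs = ∏ v, (-(G.sign (c.tail v) * G.sign (c.head v) : ℤ)) := by
  classical
  have h : ∀ v, (-(G.sign (c.tail v) * G.sign (c.head v) : ℤ)) =
      if c.tail v = c.head v then -1 else 1 := by
    intro v
    split_ifs with hv
    · rw [hv, Int.units_coe_mul_self]
    · simpa [adjSign] using congrArg Units.val (hpos _ _ hv (c.edge_head v).symm)
  rw [Finset.prod_congr rfl fun v _ => h v, Finset.prod_ite, Finset.prod_const,
    Finset.prod_const_one, mul_one, bs, Set.ncard_eq_toFinset_card']
  simp

lemma sgnD_eq [Fintype V] [DecidableEq V] (hpos : G.AllPositive)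
    (c : G.ReducedContributor u₁ u₂ w₁ w₂) :
    c.sgnD = Equiv.Perm.sign c.perm * ∏ v, (-(G.sign (c.tail v) * G.sign (c.head v) : ℤ)) := by
  rw [sgnD, nc_eq_zero hpos, add_zero, pow_add, neg_one_pow_ec, neg_one_pow_bs hpos]

end ReducedContributor

open Classical in
/-- The column of an edge in the oriented incidence matrix. -/
noncomputable def incidenceVec [Fintype I] (G : OrientedHypergraph V E I) (e : E) (v : V) : ℤ :=
  ∑ i, if G.edge i = e ∧ G.vert i = v then (G.sign i : ℤ) else 0

open Classical in
-- An entry of L is a sum over the possible steps of a contributor from `v` to `w`; the pairs with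
-- equal incidences are the backsteps.
lemma sum_incidenceVec_mul [Fintype I] [Fintype E] (G : OrientedHypergraph V E I) (v w : V) :
    ∑ e, G.incidenceVec e v * G.incidenceVec e w =
      ∑ p : I × I, if G.edge p.2 = G.edge p.1 ∧ G.vert p.1 = v ∧ G.vert p.2 = w then
        (G.sign p.1 * G.sign p.2 : ℤ) else 0 := by
  simp only [incidenceVec, Finset.sum_mul_sum]
  rw [Finset.sum_comm, Fintype.sum_prod_type]
  refine Finset.sum_congr rfl fun i _ => ?_
  rw [Finset.sum_comm]
  refine Finset.sum_congr rfl fun j _ => ?_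
  rw [Finset.sum_eq_single (G.edge i)]
  · simp only [true_and]
    split_ifs <;> first | rfl | tauto | simp
  · intro e _ he
    simp [he.symm]
  · simp

open Classical in
lemma contributorTranspedance_eq [Fintype V] [DecidableEq V] [Fintype E] [Fintype I]
    (G : OrientedHypergraph V E I)
    (hpos : G.AllPositive) {u₁ u₂ w₁ w₂ : V} (hu : u₁ ≠ u₂) (hw : w₁ ≠ w₂) :
    G.contributorTranspedance u₁ u₂ w₁ w₂ =
      (-1) ^ Fintype.card {v : V // v ≠ u₁ ∧ v ≠ u₂} *
        borderedDet (u₁ := u₁) (u₂ := u₂)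
          (fun v => ∑ e, G.incidenceVec e v.1 • G.incidenceVec e)
          (Pi.single w₁ 1) (Pi.single w₂ 1) := by
  have hL : ∀ (v : {v : V // v ≠ u₁ ∧ v ≠ u₂}) w,
      (∑ e, G.incidenceVec e v.1 • G.incidenceVec e) w =
      ∑ p : I × I, if G.edge p.2 = G.edge p.1 ∧ G.vert p.1 = v ∧ G.vert p.2 = w then
        (G.sign p.1 * G.sign p.2 : ℤ) else 0 := by
    intro v w
    have h := G.sum_incidenceVec_mul v.1 w
    rw [Finset.sum_apply]
    simp only [Pi.smul_apply, smul_eq_mul]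
    convert h
  have hdet : borderedDet (u₁ := u₁) (u₂ := u₂)
          (fun v => ∑ e, G.incidenceVec e v.1 • G.incidenceVec e)
          (Pi.single w₁ 1) (Pi.single w₂ 1) =
      ∑ x : Equiv.Perm V × ({v : V // v ≠ u₁ ∧ v ≠ u₂} → I × I),
        if x.1 u₁ = w₁ ∧ x.1 u₂ = w₂ ∧ ∀ v, G.edge (x.2 v).2 = G.edge (x.2 v).1 ∧
            G.vert (x.2 v).1 = v ∧ G.vert (x.2 v).2 = x.1 v then
          (Equiv.Perm.sign x.1 * ∏ v, (G.sign (x.2 v).1 * G.sign (x.2 v).2 : ℤ) : ℤ) else 0 := by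
    -- `Matrix.det_apply'` uses the entries at (π v, v); transposing puts v in the row and π v in
    -- the column, as for contributors.
    rw [borderedDet, ← Matrix.det_transpose, Matrix.det_apply', Fintype.sum_prod_type]
    refine Finset.sum_congr rfl fun π _ => ?_
    simp only [Matrix.transpose_apply]
    rw [prod_eq_mul_mul_prod_subtype hu, borderedMatrix_fst, borderedMatrix_snd hu]
    simp only [borderedMatrix_apply, hL, Pi.single_apply]
    rw [Finset.prod_univ_sum, Fintype.piFinset_univ, Finset.mul_sum, Finset.mul_sum]
    refine Finset.sum_congr rfl fun g _ => ?_
    rw [Finset.prod_ite_zero]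
    simp only [Finset.mem_univ, true_imp_iff]
    split_ifs <;> first | tauto | simp
  rw [hdet, contributorTranspedance, Finset.mul_sum]
  -- The nonzero terms are indexed by the contributors; every other pair of a permutation and a
  -- choice of incidences fails the condition and contributes 0.
  refine Fintype.sum_of_injective (fun c => (c.perm, fun v => (c.tail v, c.head v))) ?_ _ _ ?_ ?_
  · rintro ⟨p, t, h⟩ ⟨p', t', h'⟩ H
    simp only [Prod.mk.injEq, funext_iff] at H
    obtain ⟨rfl, H⟩ := H
    obtain rfl : t = t' := funext fun v => (H v).1
    obtain rfl : h = h' := funext fun v => (H v).2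
    rfl
  · rintro ⟨π, g⟩ hx
    rw [if_neg, mul_zero]
    rintro ⟨h₁, h₂, h⟩
    exact hx ⟨⟨π, fun v => (g v).1, fun v => (g v).2, hu, hw, h₁, h₂, fun v => (h v).2.1,
      fun v => (h v).1, fun v => (h v).2.2⟩, rfl⟩
  · intro c
    rw [if_pos ⟨c.perm_fst, c.perm_snd, fun v => ⟨c.edge_head v, c.vert_tail v, c.vert_head v⟩⟩,
      ReducedContributor.sgnD_eq hpos, Finset.prod_neg, Finset.card_univ]
    ring

end OrientedHypergraph

/-! ### Counting injections by their range -/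

/-- An injection amounts to its range `F` together with a bijection from `U` onto `F`, and there are
(card U)! of the latter. -/
lemma Nat.card_injective_range {U E : Type*} [Finite U] [Finite E] (P : Set E → Prop) :
    Nat.card {φ : U → E // Function.Injective φ ∧ P (Set.range φ)} =
      (Nat.card U).factorial * {F : Set E | F.ncard = Nat.card U ∧ P F}.ncard := by
  have := Fintype.ofFinite U
  have := Fintype.ofFinite {F : Set E // F.ncard = Nat.card U ∧ P F}
  classical
  let g : (Σ F : {F : Set E // F.ncard = Nat.card U ∧ P F}, U ≃ F.1) →
      {φ : U → E // Function.Injective φ ∧ P (Set.range φ)} := fun x =>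
    ⟨fun v => (x.2 v : E), Subtype.val_injective.comp x.2.injective, by
      have h : Set.range (fun v => (x.2 v : E)) = x.1.1 := by
        rw [← Function.comp_def Subtype.val, x.2.surjective.range_comp, Subtype.range_coe]
      rw [h]
      exact x.1.2.2⟩
  have hg : Function.Bijective g := by
    constructor
    · rintro ⟨⟨F, hF⟩, e⟩ ⟨⟨F', hF'⟩, e'⟩ h
      have h' : (fun v => (e v : E)) = fun v => (e' v : E) := congrArg Subtype.val h
      obtain rfl : F = F' := by
        have h₁ := congrArg Set.range h'
        rwa [← Function.comp_def Subtype.val, ← Function.comp_def Subtype.val,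
          e.surjective.range_comp, e'.surjective.range_comp, Subtype.range_coe,
          Subtype.range_coe] at h₁
      obtain rfl : e = e' := Equiv.ext fun v => Subtype.ext (congrFun h' v)
      rfl
    · rintro ⟨φ, hφ, hP⟩
      refine ⟨⟨⟨Set.range φ, ?_, hP⟩, Equiv.ofInjective φ hφ⟩, rfl⟩
      rw [← Set.image_univ, Set.ncard_image_of_injective _ hφ, Set.ncard_univ]
  rw [← Nat.card_congr (Equiv.ofBijective g hg), Nat.card_sigma]
  have h : ∀ F : {F : Set E // F.ncard = Nat.card U ∧ P F},
      Nat.card (U ≃ F.1) = (Nat.card U).factorial := by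
    intro F
    have := Fintype.ofFinite F.1
    have hF : Nat.card F.1 = Nat.card U := (Nat.card_coe_set_eq F.1).trans F.2.1
    obtain ⟨e⟩ : Nonempty (U ≃ F.1) := Finite.card_eq.1 hF.symm
    exact Nat.card_eq_fintype_card.trans ((Fintype.card_equiv e).trans
      (congrArg Nat.factorial Nat.card_eq_fintype_card.symm))
  rw [Finset.sum_congr rfl fun F _ => h F, Finset.sum_const, smul_eq_mul, mul_comm,
    Finset.card_univ, ← Nat.card_eq_fintype_card]
  rfl

/-! ### Bordered incidence determinants of spanning subgraphs -/

namespace OrientedHypergraph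

variable {V E I : Type*} {G : OrientedHypergraph V E I}

lemma IsLink.symm {e : E} {x y : V} (h : G.IsLink e x y) : G.IsLink e y x := by
  obtain ⟨i, j, hij, hi, hj, rfl, rfl⟩ := h
  exact ⟨j, i, hij.symm, hj, hi, rfl, rfl⟩

lemma IsBidirected.eq_or_eq (hG : G.IsBidirected) {i j k : I} (hij : i ≠ j)
    (h : G.edge i = G.edge j) (hk : G.edge k = G.edge i) : k = i ∨ k = j := by
  obtain ⟨a, b, hab, hs⟩ := Set.ncard_eq_two.1 (hG (G.edge i))
  have h₁ : ∀ l, G.edge l = G.edge i → l = a ∨ l = b := fun l hl => by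
    have : l ∈ ({a, b} : Set I) := hs ▸ hl
    simpa using this
  have hi := h₁ i rfl
  have hj := h₁ j h.symm
  have hk := h₁ k hk
  grind

lemma IsBidirected.exists_isLink (hG : G.IsBidirected) (e : E) : ∃ x y, G.IsLink e x y := by
  obtain ⟨a, b, hab, hs⟩ := Set.ncard_eq_two.1 (hG e)
  have ha : a ∈ {i : I | G.edge i = e} := by simp [hs]
  have hb : b ∈ {i : I | G.edge i = e} := by simp [hs]
  exact ⟨_, _, a, b, hab, ha, hb, rfl, rfl⟩

lemma IsBidirected.isLink_unique (hG : G.IsBidirected) {e : E} {x y x' y' : V}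
    (h : G.IsLink e x y) (h' : G.IsLink e x' y') : x' = x ∧ y' = y ∨ x' = y ∧ y' = x := by
  obtain ⟨i, j, hij, hi, hj, rfl, rfl⟩ := h
  obtain ⟨k, l, hkl, hk, hl, rfl, rfl⟩ := h'
  have h₁ := hG.eq_or_eq hij (hi.trans hj.symm) (hk.trans hi.symm)
  have h₂ := hG.eq_or_eq hij (hi.trans hj.symm) (hl.trans hi.symm)
  grind

/-- Positivity says that the two incidences have opposite orientations. For a loop, x = y and the
column is 0. -/
lemma incidenceVec_of_isLink [Fintype I] [DecidableEq V] (hG : G.IsBidirected)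
    (hpos : G.AllPositive) {e : E} {x y : V} (h : G.IsLink e x y) :
    ∃ s : ℤ, s * s = 1 ∧ G.incidenceVec e = s • (Pi.single x 1 - Pi.single y 1) := by
  classical
  obtain ⟨i, j, hij, rfl, hj, rfl, rfl⟩ := h
  have hs : (G.sign j : ℤ) = -G.sign i := by
    have h := congrArg Units.val (hpos i j hij hj.symm)
    simp only [adjSign, Units.val_neg, Units.val_mul, Units.val_one] at h
    linear_combination (-(G.sign i : ℤ)) * h - (G.sign j : ℤ) * Int.units_coe_mul_self (G.sign i)
  refine ⟨G.sign i, Int.units_coe_mul_self _, funext fun v => ?_⟩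
  refine (Fintype.sum_eq_add i j hij fun k hk =>
    if_neg fun h => (hG.eq_or_eq hij hj.symm h.1).elim hk.1 hk.2).trans ?_
  simp only [hj, hs, true_and, Pi.smul_apply, Pi.sub_apply, Pi.single_apply, smul_eq_mul,
    eq_comm (a := v)]
  split_ifs <;> ring

/-- The simple graph underlying the spanning subgraph with edge set `F`. -/
def spanningGraph (G : OrientedHypergraph V E I) (F : Set E) : SimpleGraph V :=
  SimpleGraph.fromRel fun x y => ∃ e ∈ F, G.IsLink e x y

lemma spanningGraph_adj {F : Set E} {x y : V} :
    (G.spanningGraph F).Adj x y ↔ x ≠ y ∧ ∃ e ∈ F, G.IsLink e x y := by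
  rw [spanningGraph, SimpleGraph.fromRel_adj]
  refine and_congr_right fun _ => ⟨?_, Or.inl⟩
  rintro (h | ⟨e, he, h⟩)
  exacts [h, ⟨e, he, h.symm⟩]

lemma IsLink.reachable {F : Set E} {e : E} {x y : V} (h : G.IsLink e x y) (he : e ∈ F) :
    (G.spanningGraph F).Reachable x y := by
  by_cases hxy : x = y
  · rw [hxy]
  · exact (spanningGraph_adj.2 ⟨hxy, e, he, h⟩).reachable

/-- The difference telescopes along a path, each step being ± the column of an edge of `F`. -/
lemma single_sub_single_mem_span [Fintype I] [DecidableEq V] (hG : G.IsBidirected)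
    (hpos : G.AllPositive) {F : Set E} {x y : V} (h : (G.spanningGraph F).Reachable x y) :
    (Pi.single x 1 - Pi.single y 1 : V → ℤ) ∈ Submodule.span ℤ (G.incidenceVec '' F) := by
  rw [SimpleGraph.reachable_iff_reflTransGen] at h
  induction h with
  | refl => simp
  | @tail y z _ hyz ih =>
    obtain ⟨-, e, he, hl⟩ := spanningGraph_adj.1 hyz
    obtain ⟨s, hs, hv⟩ := incidenceVec_of_isLink hG hpos hl
    have h₁ : s • G.incidenceVec e = Pi.single y 1 - Pi.single z 1 := by
      rw [hv, smul_smul, hs, one_smul]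
    rw [← sub_add_sub_cancel _ (Pi.single y 1 : V → ℤ), ← h₁]
    exact add_mem ih (Submodule.smul_mem _ _ (Submodule.subset_span ⟨e, he, rfl⟩))

open Classical in
/-- The indicator function of the component of `a`. -/
noncomputable def componentIndicator (G : OrientedHypergraph V E I) (F : Set E) (a v : V) : ℤ :=
  if (G.spanningGraph F).Reachable a v then 1 else 0

lemma componentIndicator_ne_zero (F : Set E) (a : V) : G.componentIndicator F a ≠ 0 := by
  intro h
  simpa [componentIndicator] using congrFun h a

lemma single_dotProduct_componentIndicator [Fintype V] [DecidableEq V] {F : Set E} {a v : V}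
    (h : ¬ (G.spanningGraph F).Reachable a v) :
    Pi.single v 1 ⬝ᵥ G.componentIndicator F a = 0 := by
  rw [single_one_dotProduct, componentIndicator, if_neg h]

/-- The indicator takes the same value at both ends of an edge of `F`, and the column is a multiple
of the difference of the unit vectors there. -/
lemma incidenceVec_dotProduct_componentIndicator [Fintype V] [Fintype I] (hG : G.IsBidirected)
    (hpos : G.AllPositive) {F : Set E} {e : E} (he : e ∈ F) (a : V) :
    G.incidenceVec e ⬝ᵥ G.componentIndicator F a = 0 := by
  classical
  obtain ⟨x, y, hl⟩ := hG.exists_isLink e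
  obtain ⟨s, -, hv⟩ := incidenceVec_of_isLink hG hpos hl
  have hr := hl.reachable he
  have h : G.componentIndicator F a x = G.componentIndicator F a y := by
    have h : (G.spanningGraph F).Reachable a x ↔ (G.spanningGraph F).Reachable a y :=
      ⟨fun h => h.trans hr, fun h => h.trans hr.symm⟩
    rw [componentIndicator, componentIndicator]
    congr 1
    exact propext h
  rw [hv, smul_dotProduct, sub_dotProduct, single_one_dotProduct, single_one_dotProduct, h,
    sub_self, smul_zero]

/-- The spanning subgraph with edge set `F` has exactly two components, one that contains `u₁`
and `w₁` and one that contains `u₂` and `w₂`. -/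
structure Splits (G : OrientedHypergraph V E I) (F : Set E) (u₁ w₁ u₂ w₂ : V) : Prop where
  cover : ∀ v, (G.spanningGraph F).Reachable u₁ v ∨ (G.spanningGraph F).Reachable u₂ v
  separated : ¬ (G.spanningGraph F).Reachable u₁ u₂
  fst : (G.spanningGraph F).Reachable u₁ w₁
  snd : (G.spanningGraph F).Reachable u₂ w₂

variable [Fintype V] [DecidableEq V] [Fintype I] {u₁ u₂ w₁ w₂ : V}

lemma Splits.borderedDet_eq (hG : G.IsBidirected) (hpos : G.AllPositive) (hu : u₁ ≠ u₂)
    {φ : {v : V // v ≠ u₁ ∧ v ≠ u₂} → E} (h : G.Splits (Set.range φ) u₁ w₁ u₂ w₂) :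
    borderedDet (fun v => G.incidenceVec (φ v)) (Pi.single w₁ 1) (Pi.single w₂ 1) =
      borderedDet (fun v => G.incidenceVec (φ v)) (Pi.single u₁ 1) (Pi.single u₂ 1) := by
  have hr : Set.range (fun v => G.incidenceVec (φ v)) = G.incidenceVec '' Set.range φ :=
    Set.range_comp G.incidenceVec φ
  rw [borderedDet_congr_left, borderedDet_congr_right hu]
  · rw [hr]
    exact single_sub_single_mem_span hG hpos h.snd.symm
  · rw [hr]
    exact single_sub_single_mem_span hG hpos h.fst.symm

/-- Every vertex lies in the component of u₁ or of u₂, so its unit vector is that of u₁ or u₂ modulo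
the edge rows; hence the rows generate ℤ^V. -/
lemma Splits.borderedDet_mul_self (hG : G.IsBidirected) (hpos : G.AllPositive) (hu : u₁ ≠ u₂)
    {φ : {v : V // v ≠ u₁ ∧ v ≠ u₂} → E} (h : G.Splits (Set.range φ) u₁ w₁ u₂ w₂) :
    borderedDet (fun v => G.incidenceVec (φ v)) (Pi.single u₁ 1) (Pi.single u₂ 1) *
      borderedDet (fun v => G.incidenceVec (φ v)) (Pi.single u₁ 1) (Pi.single u₂ 1) = 1 := by
  have hr : Set.range (fun v => G.incidenceVec (φ v)) = G.incidenceVec '' Set.range φ :=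
    Set.range_comp G.incidenceVec φ
  refine _root_.borderedDet_mul_self hu _ _ _ fun v => ?_
  rw [hr]
  obtain ⟨u, hu', hv⟩ : ∃ u ∈ ({u₁, u₂} : Set V), (G.spanningGraph (Set.range φ)).Reachable v u := by
    rcases h.cover v with h | h
    exacts [⟨u₁, by simp, h.symm⟩, ⟨u₂, by simp, h.symm⟩]
  rw [← sub_add_cancel (Pi.single v 1 : V → ℤ) (Pi.single u 1)]
  refine Submodule.add_mem_sup (single_sub_single_mem_span hG hpos hv)
    (Submodule.subset_span ?_)
  rcases hu' with rfl | rfl <;> simp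

lemma borderedDet_mul_eq_zero (hG : G.IsBidirected) (hpos : G.AllPositive) (hu : u₁ ≠ u₂)
    {φ : {v : V // v ≠ u₁ ∧ v ≠ u₂} → E} (h₁ : ¬ G.Splits (Set.range φ) u₁ w₁ u₂ w₂)
    (h₂ : ¬ G.Splits (Set.range φ) u₁ w₂ u₂ w₁) :
    borderedDet (fun v => G.incidenceVec (φ v)) (Pi.single u₁ 1) (Pi.single u₂ 1) *
      borderedDet (fun v => G.incidenceVec (φ v)) (Pi.single w₁ 1) (Pi.single w₂ 1) = 0 := by
  have hr : Set.range (fun v => G.incidenceVec (φ v)) = G.incidenceVec '' Set.range φ :=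
    Set.range_comp G.incidenceVec φ
  -- If the component of a contains neither border vertex, its indicator is a nonzero vector in the
  -- kernel.
  have hzero : ∀ {a x y : V}, ¬ (G.spanningGraph (Set.range φ)).Reachable a x →
      ¬ (G.spanningGraph (Set.range φ)).Reachable a y →
      borderedDet (fun v => G.incidenceVec (φ v)) (Pi.single x 1) (Pi.single y 1) = 0 :=
    fun hx hy => borderedDet_eq_zero_of_dotProduct hu (componentIndicator_ne_zero _ _)
      (fun v => incidenceVec_dotProduct_componentIndicator hG hpos (Set.mem_range_self v) _)
      (single_dotProduct_componentIndicator hx) (single_dotProduct_componentIndicator hy)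
  by_cases hc : ∀ v, (G.spanningGraph (Set.range φ)).Reachable u₁ v ∨
      (G.spanningGraph (Set.range φ)).Reachable u₂ v
  swap
  · push Not at hc
    obtain ⟨v, hv₁, hv₂⟩ := hc
    -- The component of v avoids u₁ and u₂, which kills the first factor.
    rw [hzero (fun h => hv₁ h.symm) (fun h => hv₂ h.symm), zero_mul]
  by_cases hs : (G.spanningGraph (Set.range φ)).Reachable u₁ u₂
  · rw [borderedDet_congr_left (p' := Pi.single u₂ 1), borderedDet_self hu, zero_mul]
    rw [hr]
    exact single_sub_single_mem_span hG hpos hs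
  have hs₁ : ∀ v, (G.spanningGraph (Set.range φ)).Reachable u₁ v →
      ¬ (G.spanningGraph (Set.range φ)).Reachable u₂ v := fun v h h' => hs (h.trans h'.symm)
  rcases hc w₁ with hw₁ | hw₁ <;> rcases hc w₂ with hw₂ | hw₂
  · rw [hzero (hs₁ _ hw₁) (hs₁ _ hw₂), mul_zero]
  · exact absurd ⟨hc, hs, hw₁, hw₂⟩ h₁
  · exact absurd ⟨hc, hs, hw₂, hw₁⟩ h₂
  · rw [hzero (fun h => hs₁ _ h hw₁) (fun h => hs₁ _ h hw₂), mul_zero]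

open Classical in
lemma borderedDet_mul_borderedDet (hG : G.IsBidirected) (hpos : G.AllPositive) (hu : u₁ ≠ u₂)
    (φ : {v : V // v ≠ u₁ ∧ v ≠ u₂} → E) :
    borderedDet (fun v => G.incidenceVec (φ v)) (Pi.single u₁ 1) (Pi.single u₂ 1) *
      borderedDet (fun v => G.incidenceVec (φ v)) (Pi.single w₁ 1) (Pi.single w₂ 1) =
    (if Function.Injective φ ∧ G.Splits (Set.range φ) u₁ w₁ u₂ w₂ then 1 else 0) -
      if Function.Injective φ ∧ G.Splits (Set.range φ) u₁ w₂ u₂ w₁ then 1 else 0 := by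
  by_cases hφ : Function.Injective φ
  swap
  · rw [if_neg fun h => hφ h.1, if_neg fun h => hφ h.1, sub_zero,
      borderedDet_eq_zero_of_not_injective, zero_mul]
    exact fun h => hφ fun v w hvw => h (congrArg G.incidenceVec hvw)
  simp only [hφ, true_and]
  by_cases h₁ : G.Splits (Set.range φ) u₁ w₁ u₂ w₂
  · have h₂ : ¬ G.Splits (Set.range φ) u₁ w₂ u₂ w₁ :=
      fun h => h₁.separated (h.fst.trans h₁.snd.symm)
    rw [if_pos h₁, if_neg h₂, sub_zero, h₁.borderedDet_eq hG hpos hu,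
      h₁.borderedDet_mul_self hG hpos hu]
  rw [if_neg h₁]
  by_cases h₂ : G.Splits (Set.range φ) u₁ w₂ u₂ w₁
  · rw [if_pos h₂, borderedDet_swap hu _ (Pi.single w₂ 1), h₂.borderedDet_eq hG hpos hu, mul_neg,
      h₂.borderedDet_mul_self hG hpos hu, zero_sub]
  · rw [if_neg h₂, sub_zero, borderedDet_mul_eq_zero hG hpos hu h₁ h₂]

lemma borderedDet_laplacian [Fintype E] (hG : G.IsBidirected) (hpos : G.AllPositive)
    (hu : u₁ ≠ u₂) :
    borderedDet (u₁ := u₁) (u₂ := u₂) (fun v => ∑ e, G.incidenceVec e v.1 • G.incidenceVec e)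
        (Pi.single w₁ 1) (Pi.single w₂ 1) =
      ({F : Set E | F.ncard = Nat.card {v : V // v ≠ u₁ ∧ v ≠ u₂} ∧
          G.Splits F u₁ w₁ u₂ w₂}.ncard : ℤ) -
        {F : Set E | F.ncard = Nat.card {v : V // v ≠ u₁ ∧ v ≠ u₂} ∧
          G.Splits F u₁ w₂ u₂ w₁}.ncard := by
  classical
  have h := factorial_mul_borderedDet hu G.incidenceVec (Pi.single w₁ 1) (Pi.single w₂ 1)
  rw [Finset.sum_congr rfl fun φ _ => borderedDet_mul_borderedDet hG hpos hu φ,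
    Finset.sum_sub_distrib, Finset.sum_boole, Finset.sum_boole, ← Fintype.card_subtype,
    ← Fintype.card_subtype, ← Nat.card_eq_fintype_card, ← Nat.card_eq_fintype_card,
    ← Nat.card_eq_fintype_card, Nat.card_injective_range (fun F => G.Splits F u₁ w₁ u₂ w₂),
    Nat.card_injective_range (fun F => G.Splits F u₁ w₂ u₂ w₁), Nat.cast_mul, Nat.cast_mul,
    ← mul_sub] at h
  exact mul_left_cancel₀ (Nat.cast_ne_zero.2 (Nat.factorial_ne_zero _)) h

end OrientedHypergraph

/-! ### Two-component edge sets and 2-arborescences -/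

namespace OrientedHypergraph

variable {V E I : Type*} {G : OrientedHypergraph V E I}

lemma simpleGraphOn_adj {S : Set V} {F : Set E} {x y : S} :
    (G.simpleGraphOn S F).Adj x y ↔ x ≠ y ∧ ∃ e ∈ F, G.IsLink e x y := by
  rw [simpleGraphOn, SimpleGraph.fromRel_adj]
  refine and_congr_right fun _ => ⟨?_, Or.inl⟩
  rintro (h | ⟨e, he, h⟩)
  exacts [h, ⟨e, he, h.symm⟩]

lemma exists_endpoints (hG : G.IsBidirected) {S : Set V} {F : Set E}
    (hS : ∀ e ∈ F, ∀ x y, G.IsLink e x y → x ∈ S ∧ y ∈ S) :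
    ∃ g : F → S × S, ∀ e : F, G.IsLink e (g e).1 (g e).2 := by
  have h : ∀ e : F, ∃ p : S × S, G.IsLink e p.1 p.2 := by
    intro e
    obtain ⟨x, y, h⟩ := hG.exists_isLink e.1
    exact ⟨(⟨x, (hS e e.2 x y h).1⟩, ⟨y, (hS e e.2 x y h).2⟩), h⟩
  choose g hg using h
  exact ⟨g, hg⟩

lemma IsLink.mk_eq_mk (hG : G.IsBidirected) {S : Set V} {e : E} {x y x' y' : S}
    (h : G.IsLink e x y) (h' : G.IsLink e x' y') : s(x, y) = s(x', y') := by
  rw [Sym2.eq_iff]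
  simp only [← Subtype.coe_inj]
  exact hG.isLink_unique h' h

lemma edgeSet_subset_range (hG : G.IsBidirected) {S : Set V} {F : Set E} {g : F → S × S}
    (hg : ∀ e : F, G.IsLink e (g e).1 (g e).2) :
    (G.simpleGraphOn S F).edgeSet ⊆ Set.range fun e => s((g e).1, (g e).2) := by
  intro z
  induction z with
  | _ x y =>
    intro h
    obtain ⟨-, e, he, hl⟩ := simpleGraphOn_adj.1 ((SimpleGraph.mem_edgeSet _).1 h)
    exact ⟨⟨e, he⟩, IsLink.mk_eq_mk hG (hg ⟨e, he⟩) hl⟩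

lemma card_range_endpoints_le [Finite E] {S : Set V} {F : Set E} (g : F → S × S) :
    (Set.range fun e => s((g e).1, (g e).2)).ncard ≤ F.ncard := by
  rw [← Set.image_univ, ← Nat.card_coe_set_eq F, ← Set.ncard_univ]
  exact Set.ncard_image_le

lemma card_le_card_add_one_of_connected [Finite V] [Finite E] (hG : G.IsBidirected) {S : Set V}
    {F : Set E} (hS : ∀ e ∈ F, ∀ x y, G.IsLink e x y → x ∈ S ∧ y ∈ S)
    (hc : (G.simpleGraphOn S F).Connected) : S.ncard ≤ F.ncard + 1 := by
  obtain ⟨g, hg⟩ := exists_endpoints hG hS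
  have h₁ := hc.card_vert_le_card_edgeSet_add_one
  have h₂ := Set.ncard_le_ncard (edgeSet_subset_range hG hg) (Set.toFinite _)
  have h₃ := card_range_endpoints_le g
  rw [Nat.card_coe_set_eq, Nat.card_coe_set_eq] at h₁
  omega

/-- Without loops and parallel edges, sending an edge to its pair of ends is a bijection from `F`
onto the edges of the simple graph, which is a tree. -/
lemma IsSubtree.card_add_one [Finite V] [Finite E] (hG : G.IsBidirected) {S : Set V} {F : Set E}
    (h : G.IsSubtree S F) : F.ncard + 1 = S.ncard := by
  obtain ⟨g, hg⟩ := exists_endpoints hG h.ends_mem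
  have h₁ := (SimpleGraph.isTree_iff_connected_and_card.1 h.isTree).2
  have h₂ : (G.simpleGraphOn S F).edgeSet = Set.range fun e => s((g e).1, (g e).2) := by
    refine (edgeSet_subset_range hG hg).antisymm ?_
    rintro _ ⟨e, rfl⟩
    rw [SimpleGraph.mem_edgeSet, simpleGraphOn_adj]
    exact ⟨fun heq => h.loopless e e.2 _ (heq ▸ hg e), e, e.2, hg e⟩
  have hinj : Function.Injective fun e => s((g e).1, (g e).2) := by
    intro e f hef
    rcases Sym2.eq_iff.1 hef with ⟨h₁, h₂⟩ | ⟨h₁, h₂⟩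
    · exact Subtype.ext (h.no_parallel e e.2 f f.2 _ _ (hg e) (by rw [h₁, h₂]; exact hg f))
    · exact Subtype.ext (h.no_parallel e e.2 f f.2 _ _ (hg e) (by rw [h₁, h₂]; exact (hg f).symm))
  rw [h₂, Nat.card_coe_set_eq, Nat.card_coe_set_eq, ← Set.image_univ,
    Set.ncard_image_of_injective _ hinj, Set.ncard_univ, Nat.card_coe_set_eq] at h₁
  exact h₁

/-- In |S| - 1 ≤ |edges of the simple graph| ≤ |pairs of ends| ≤ |F| = |S| - 1 equality holds
throughout. Equality in the second place excludes loops, and in the third parallel edges. -/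
lemma isSubtree_of_connected [Finite V] [Finite E] (hG : G.IsBidirected) {S : Set V} {F : Set E}
    (hS : ∀ e ∈ F, ∀ x y, G.IsLink e x y → x ∈ S ∧ y ∈ S)
    (hc : (G.simpleGraphOn S F).Connected) (hcard : F.ncard + 1 = S.ncard) :
    G.IsSubtree S F := by
  obtain ⟨g, hg⟩ := exists_endpoints hG hS
  have h₁ := hc.card_vert_le_card_edgeSet_add_one
  have hsub := edgeSet_subset_range hG hg
  have h₂ := Set.ncard_le_ncard hsub (Set.toFinite _)
  have h₃ := card_range_endpoints_le g
  rw [Nat.card_coe_set_eq, Nat.card_coe_set_eq] at h₁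
  have heq := Set.eq_of_subset_of_ncard_le hsub (by omega) (Set.toFinite _)
  have hinj : Function.Injective fun e => s((g e).1, (g e).2) := by
    rw [← Set.injOn_univ]
    refine (Set.ncard_image_iff (Set.toFinite _)).1 ?_
    rw [Set.image_univ, Set.ncard_univ, Nat.card_coe_set_eq]
    omega
  refine ⟨hS, ?_, ?_, SimpleGraph.isTree_iff_connected_and_card.2 ⟨hc, ?_⟩⟩
  · intro e he x hl
    have hmem : s((g ⟨e, he⟩).1, (g ⟨e, he⟩).2) ∈ (G.simpleGraphOn S F).edgeSet :=
      heq ▸ Set.mem_range_self _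
    rw [← IsLink.mk_eq_mk hG (x := ⟨x, (hS e he x x hl).1⟩) (y := ⟨x, (hS e he x x hl).1⟩) hl
      (hg ⟨e, he⟩), SimpleGraph.mem_edgeSet] at hmem
    exact hmem.ne rfl
  · intro e he f hf x y hle hlf
    have hx := hS e he x y hle
    have h := (IsLink.mk_eq_mk hG (x := ⟨x, hx.1⟩) (y := ⟨y, hx.2⟩) hle (hg ⟨e, he⟩)).symm.trans
      (IsLink.mk_eq_mk hG (x := ⟨x, hx.1⟩) (y := ⟨y, hx.2⟩) hlf (hg ⟨f, hf⟩))
    exact congrArg Subtype.val (hinj h)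
  · rw [Nat.card_coe_set_eq, Nat.card_coe_set_eq]
    omega

/-- The edges of `F` in the component of `a`. -/
def componentEdges (G : OrientedHypergraph V E I) (F : Set E) (a : V) : Set E :=
  {e ∈ F | ∃ x y, G.IsLink e x y ∧ (G.spanningGraph F).Reachable a x}

lemma componentEdges_ends_mem (hG : G.IsBidirected) (F : Set E) (a : V) :
    ∀ e ∈ G.componentEdges F a, ∀ x y, G.IsLink e x y →
      x ∈ {v | (G.spanningGraph F).Reachable a v} ∧
        y ∈ {v | (G.spanningGraph F).Reachable a v} := by
  rintro e ⟨he, x', y', hl', hr⟩ x y hl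
  have hr' := hr.trans (hl'.reachable he)
  rcases hG.isLink_unique hl' hl with ⟨rfl, rfl⟩ | ⟨rfl, rfl⟩
  exacts [⟨hr, hr'⟩, ⟨hr', hr⟩]

lemma connected_component (F : Set E) (a : V) :
    (G.simpleGraphOn {v | (G.spanningGraph F).Reachable a v}
      (G.componentEdges F a)).Connected := by
  have key : ∀ v (h : (G.spanningGraph F).Reachable a v),
      (G.simpleGraphOn {v | (G.spanningGraph F).Reachable a v} (G.componentEdges F a)).Reachable
        ⟨a, SimpleGraph.Reachable.refl a⟩ ⟨v, h⟩ := by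
    intro v h
    have h' := (SimpleGraph.reachable_iff_reflTransGen _ _).1 h
    induction h' with
    | refl => exact SimpleGraph.Reachable.refl _
    | @tail y z hy hyz ih =>
      have hy' := (SimpleGraph.reachable_iff_reflTransGen _ _).2 hy
      obtain ⟨hne, e, he, hl⟩ := spanningGraph_adj.1 hyz
      refine (ih hy').trans (SimpleGraph.Adj.reachable ?_)
      exact simpleGraphOn_adj.2 ⟨fun h => hne (congrArg Subtype.val h), e,
        ⟨he, y, z, hl, hy'⟩, hl⟩
  rw [SimpleGraph.connected_iff_exists_forall_reachable]
  exact ⟨⟨a, SimpleGraph.Reachable.refl a⟩, fun v => key v v.2⟩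

lemma card_add_card_of_disjoint_of_union_eq_univ [Finite V] {S T : Set V} (hd : Disjoint S T)
    (hST : S ∪ T = Set.univ) : S.ncard + T.ncard = Nat.card V := by
  rw [← Set.ncard_union_eq hd, hST, Set.ncard_univ]

lemma Splits.union_eq_univ {F : Set E} {u₁ w₁ u₂ w₂ : V} (h : G.Splits F u₁ w₁ u₂ w₂) :
    {v | (G.spanningGraph F).Reachable u₁ v} ∪ {v | (G.spanningGraph F).Reachable u₂ v} =
      Set.univ :=
  Set.eq_univ_of_forall h.cover

lemma Splits.disjoint {F : Set E} {u₁ w₁ u₂ w₂ : V} (h : G.Splits F u₁ w₁ u₂ w₂) :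
    Disjoint {v | (G.spanningGraph F).Reachable u₁ v}
      {v | (G.spanningGraph F).Reachable u₂ v} :=
  Set.disjoint_left.2 fun _ h₁ h₂ => h.separated (h₁.trans (SimpleGraph.Reachable.symm h₂))

lemma Splits.componentEdges_union (hG : G.IsBidirected) {F : Set E} {u₁ w₁ u₂ w₂ : V}
    (h : G.Splits F u₁ w₁ u₂ w₂) : G.componentEdges F u₁ ∪ G.componentEdges F u₂ = F := by
  refine Set.Subset.antisymm (Set.union_subset (fun e he => he.1) fun e he => he.1) ?_
  intro e he
  obtain ⟨x, y, hl⟩ := hG.exists_isLink e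
  exact (h.cover x).imp (fun hx => ⟨he, x, y, hl, hx⟩) fun hx => ⟨he, x, y, hl, hx⟩

lemma disjoint_of_ends_mem (hG : G.IsBidirected) {S T : Set V} {F F' : Set E}
    (hS : ∀ e ∈ F, ∀ x y, G.IsLink e x y → x ∈ S ∧ y ∈ S)
    (hT : ∀ e ∈ F', ∀ x y, G.IsLink e x y → x ∈ T ∧ y ∈ T) (hd : Disjoint S T) :
    Disjoint F F' := by
  refine Set.disjoint_left.2 fun e he he' => ?_
  obtain ⟨x, y, hl⟩ := hG.exists_isLink e
  exact Set.disjoint_left.1 hd (hS e he x y hl).1 (hT e he' x y hl).1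

/-- A connected component has at most one vertex more than it has edges. Over the two components
these bounds add up to |V| ≤ |F| + 2, which is an equality, so both are sharp. -/
lemma Splits.isSubtree [Finite V] [Finite E] (hG : G.IsBidirected) {F : Set E}
    {u₁ w₁ u₂ w₂ : V} (h : G.Splits F u₁ w₁ u₂ w₂) (hcard : F.ncard + 2 = Nat.card V) :
    G.IsSubtree {v | (G.spanningGraph F).Reachable u₁ v} (G.componentEdges F u₁) ∧
      G.IsSubtree {v | (G.spanningGraph F).Reachable u₂ v} (G.componentEdges F u₂) := by
  have h₁ := componentEdges_ends_mem hG F u₁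
  have h₂ := componentEdges_ends_mem hG F u₂
  have hV := card_add_card_of_disjoint_of_union_eq_univ h.disjoint h.union_eq_univ
  have hE := Set.ncard_union_eq (disjoint_of_ends_mem hG h₁ h₂ h.disjoint)
    (Set.toFinite _) (Set.toFinite _)
  rw [h.componentEdges_union hG] at hE
  have hle₁ := card_le_card_add_one_of_connected hG h₁ (connected_component F u₁)
  have hle₂ := card_le_card_add_one_of_connected hG h₂ (connected_component F u₂)
  exact ⟨isSubtree_of_connected hG h₁ (connected_component F u₁) (by omega),
    isSubtree_of_connected hG h₂ (connected_component F u₂) (by omega)⟩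

lemma RootedTree.ext' {T T' : G.RootedTree} (hv : T.verts = T'.verts) (he : T.edges = T'.edges)
    (hr : T.root = T'.root) : T = T' := by
  cases T
  cases T'
  subst hv he hr
  rfl

/-- If every edge of `F` that meets the tree `T` belongs to `T`, then the vertices of `T` are those
reachable from its root in `F`. -/
lemma RootedTree.reachable_iff {T : G.RootedTree} {F : Set E}
    (hsub : T.edges ⊆ F)
    (hF : ∀ e ∈ F, ∀ x y, G.IsLink e x y → x ∈ T.verts → e ∈ T.edges) (v : V) :
    (G.spanningGraph F).Reachable T.root v ↔ v ∈ T.verts := by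
  constructor
  · intro h
    rw [SimpleGraph.reachable_iff_reflTransGen] at h
    induction h with
    | refl => exact T.root_mem
    | @tail y z _ hyz ih =>
      obtain ⟨-, e, he, hl⟩ := spanningGraph_adj.1 hyz
      exact (T.isSubtree.ends_mem e (hF e he y z hl ih) y z hl).2
  · intro hv
    let f : G.simpleGraphOn T.verts T.edges →g G.spanningGraph F :=
      { toFun := Subtype.val
        map_rel' := by
          intro x y hxy
          obtain ⟨hne, e, he, hl⟩ := simpleGraphOn_adj.1 hxy
          exact spanningGraph_adj.2 ⟨fun h => hne (Subtype.ext h), e, hsub he, hl⟩ }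
    exact (T.isSubtree.isTree.connected.preconnected ⟨T.root, T.root_mem⟩ ⟨v, hv⟩).map f

lemma RootedTree.edges_eq_componentEdges (hG : G.IsBidirected) {T : G.RootedTree} {F : Set E}
    (hsub : T.edges ⊆ F)
    (hF : ∀ e ∈ F, ∀ x y, G.IsLink e x y → x ∈ T.verts → e ∈ T.edges) :
    T.edges = G.componentEdges F T.root := by
  refine Set.Subset.antisymm (fun e he => ?_) ?_
  · obtain ⟨x, y, hl⟩ := hG.exists_isLink e
    exact ⟨hsub he, x, y, hl,
      (reachable_iff hsub hF x).2 (T.isSubtree.ends_mem e he x y hl).1⟩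
  · rintro e ⟨he, x, y, hl, hr⟩
    exact hF e he x y hl ((reachable_iff hsub hF x).1 hr)

namespace TwoArborescence

/-- The edge set of a `2`-arborescence. -/
def edges (A : G.TwoArborescence) : Set E := A.first.edges ∪ A.second.edges

lemma mem_first_edges (A : G.TwoArborescence) :
    ∀ e ∈ A.edges, ∀ x y, G.IsLink e x y → x ∈ A.first.verts → e ∈ A.first.edges := by
  rintro e (he | he) x y hl hx
  · exact he
  · exact absurd (A.second.isSubtree.ends_mem e he x y hl).1 (Set.disjoint_left.1 A.disjoint hx)

lemma mem_second_edges (A : G.TwoArborescence) :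
    ∀ e ∈ A.edges, ∀ x y, G.IsLink e x y → x ∈ A.second.verts → e ∈ A.second.edges := by
  rintro e (he | he) x y hl hx
  · exact absurd hx (Set.disjoint_left.1 A.disjoint (A.first.isSubtree.ends_mem e he x y hl).1)
  · exact he

lemma reachable_first (A : G.TwoArborescence) (v : V) :
    (G.spanningGraph A.edges).Reachable A.first.root v ↔ v ∈ A.first.verts :=
  RootedTree.reachable_iff Set.subset_union_left A.mem_first_edges v

lemma reachable_second (A : G.TwoArborescence) (v : V) :
    (G.spanningGraph A.edges).Reachable A.second.root v ↔ v ∈ A.second.verts :=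
  RootedTree.reachable_iff Set.subset_union_right A.mem_second_edges v

/-- Each tree is the component of its root in the union of the two edge sets, so the roots and this
union determine both trees. -/
lemma ext_edges (hG : G.IsBidirected) {A B : G.TwoArborescence}
    (h₁ : A.first.root = B.first.root) (h₂ : A.second.root = B.second.root)
    (h : A.edges = B.edges) : A = B := by
  have hf : A.first = B.first := by
    refine RootedTree.ext' (Set.ext fun v => ?_) ?_ h₁
    · rw [← reachable_first, ← reachable_first, h₁, h]
    · rw [RootedTree.edges_eq_componentEdges hG Set.subset_union_left A.mem_first_edges,
        RootedTree.edges_eq_componentEdges hG Set.subset_union_left B.mem_first_edges, h₁]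
      exact congrArg (fun F => G.componentEdges F B.first.root) h
  have hs : A.second = B.second := by
    refine RootedTree.ext' (Set.ext fun v => ?_) ?_ h₂
    · rw [← reachable_second, ← reachable_second, h₂, h]
    · rw [RootedTree.edges_eq_componentEdges hG Set.subset_union_right A.mem_second_edges,
        RootedTree.edges_eq_componentEdges hG Set.subset_union_right B.mem_second_edges, h₂]
      exact congrArg (fun F => G.componentEdges F B.second.root) h
  cases A
  cases B
  subst hf hs
  rfl

lemma card_edges [Finite V] [Finite E] (hG : G.IsBidirected) (A : G.TwoArborescence) :
    A.edges.ncard + 2 = Nat.card V := by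
  have hE := Set.ncard_union_eq (disjoint_of_ends_mem hG A.first.isSubtree.ends_mem
    A.second.isSubtree.ends_mem A.disjoint) (Set.toFinite _) (Set.toFinite _)
  have hV := card_add_card_of_disjoint_of_union_eq_univ A.disjoint A.spans
  have h₁ := A.first.isSubtree.card_add_one hG
  have h₂ := A.second.isSubtree.card_add_one hG
  rw [edges]
  omega

lemma splits (A : G.TwoArborescence) {w₁ w₂ : V} (h₁ : w₁ ∈ A.first.verts)
    (h₂ : w₂ ∈ A.second.verts) : G.Splits A.edges A.first.root w₁ A.second.root w₂ where
  cover v := by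
    rw [reachable_first, reachable_second, ← Set.mem_union, A.spans]
    trivial
  separated h := Set.disjoint_left.1 A.disjoint ((A.reachable_first _).1 h) A.second.root_mem
  fst := (A.reachable_first _).2 h₁
  snd := (A.reachable_second _).2 h₂

end TwoArborescence

/-- Taking edge sets is a bijection; its inverse takes the components of u₁ and u₂ as the two trees.
-/
lemma twoArborescenceCount_eq [Finite V] [Finite E] (hG : G.IsBidirected) (u₁ w₁ u₂ w₂ : V) :
    G.twoArborescenceCount u₁ w₁ u₂ w₂ =
      {F : Set E | F.ncard + 2 = Nat.card V ∧ G.Splits F u₁ w₁ u₂ w₂}.ncard := by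
  refine Set.ncard_congr (fun A _ => A.edges) ?_ ?_ ?_
  · rintro A ⟨rfl, h₁, rfl, h₂⟩
    exact ⟨A.card_edges hG, A.splits h₁ h₂⟩
  · rintro A B ⟨hA₁, -, hA₂, -⟩ ⟨hB₁, -, hB₂, -⟩ h
    exact TwoArborescence.ext_edges hG (hA₁.trans hB₁.symm) (hA₂.trans hB₂.symm) h
  · rintro F ⟨hF, h⟩
    obtain ⟨h₁, h₂⟩ := h.isSubtree hG hF
    exact ⟨⟨⟨_, _, u₁, h₁, SimpleGraph.Reachable.refl _⟩,
      ⟨_, _, u₂, h₂, SimpleGraph.Reachable.refl _⟩, h.disjoint, h.union_eq_univ⟩,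
      ⟨rfl, h.fst, rfl, h.snd⟩, h.componentEdges_union hG⟩

lemma transpedance_of_source_eq (G : OrientedHypergraph V E I) (u w₁ w₂ : V) :
    G.transpedance u u w₁ w₂ = 0 := by
  have h : ∀ x y, G.twoArborescenceCount u x u y = 0 := by
    intro x y
    have : {A : G.TwoArborescence | A.first.root = u ∧ x ∈ A.first.verts ∧
        A.second.root = u ∧ y ∈ A.second.verts} = ∅ :=
      Set.eq_empty_of_forall_notMem fun A hA => Set.disjoint_left.1 A.disjoint A.first.root_mem
        (hA.1.trans hA.2.2.1.symm ▸ A.second.root_mem)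
    rw [twoArborescenceCount, this, Set.ncard_empty]
  rw [transpedance, h, h, sub_self]

end OrientedHypergraph

theorem corollary3p5 {V E I : Type*} [Fintype V] [Finite E] [Finite I]
    (G : OrientedHypergraph V E I) (hG : G.IsBidirected) (hpos : G.AllPositive)
    (u₁ u₂ w₁ w₂ : V) :
    G.transpedance u₁ u₂ w₁ w₂ =
      (-1) ^ Fintype.card V * G.contributorTranspedance u₁ u₂ w₁ w₂ := by
  classical
  have := Fintype.ofFinite E
  have := Fintype.ofFinite I
  by_cases hu : u₁ = u₂
  · subst hu
    have : IsEmpty (G.ReducedContributor u₁ u₁ w₁ w₂) := ⟨fun c => c.source_ne rfl⟩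
    rw [G.transpedance_of_source_eq, OrientedHypergraph.contributorTranspedance,
      Finset.univ_eq_empty, Finset.sum_empty, mul_zero]
  by_cases hw : w₁ = w₂
  · subst hw
    have : IsEmpty (G.ReducedContributor u₁ u₂ w₁ w₁) := ⟨fun c => c.target_ne rfl⟩
    rw [OrientedHypergraph.transpedance, sub_self, OrientedHypergraph.contributorTranspedance,
      Finset.univ_eq_empty, Finset.sum_empty, mul_zero]
  have hcard : Fintype.card {v : V // v ≠ u₁ ∧ v ≠ u₂} + 2 = Fintype.card V := by
    -- The product of the constant 2 over V gives 2^|V| = 2 · 2 · 2^m, and exponents are compared.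
    have h := prod_eq_mul_mul_prod_subtype hu fun _ => 2
    simp only [Finset.prod_const, Finset.card_univ] at h
    refine Nat.pow_right_injective le_rfl ?_
    change 2 ^ _ = 2 ^ _
    rw [h]
    ring
  have hiff : ∀ F : Set E, F.ncard + 2 = Nat.card V ↔
      F.ncard = Nat.card {v : V // v ≠ u₁ ∧ v ≠ u₂} := by
    intro F
    rw [Nat.card_eq_fintype_card, Nat.card_eq_fintype_card, ← hcard, Nat.add_right_cancel_iff]
  rw [G.contributorTranspedance_eq hpos hu hw, OrientedHypergraph.borderedDet_laplacian hG hpos hu,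
    OrientedHypergraph.transpedance, OrientedHypergraph.twoArborescenceCount_eq hG,
    OrientedHypergraph.twoArborescenceCount_eq hG]
  simp only [hiff]
  -- The two signs combine to exponent (m + 2) + m = 2(m + 1).
  rw [← mul_assoc, ← pow_add, ← hcard, Even.neg_one_pow, one_mul]
  exact ⟨Fintype.card {v : V // v ≠ u₁ ∧ v ≠ u₂} + 1, by omega⟩
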